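/- Let $\mathcal P$ be a set of prime numbers with $2\notin\mathcal P$ (finite or infinite), and let $X$ be the weak direct product (direct sum) of the cyclic groups $\mathbb Z(p)$ of order $p$, $p\in\mathcal P$, considered in the discrete topology. Let $\alpha$ be an automorphism of $X$ and let $I$ be the identity automorphism. Let $\xi_1,\xi_2$ be independent random variables with values in $X$ and distributions $\mu_1,\mu_2$. Assume that the conditional distribution of $L_2=\xi_1+\alpha\xi_2$ given $L_1=\xi_1+\xi_2$ is symmetric. Then there are a subgroup $G$ of $X$ and a probability distribution $\lambda$ on $X$ supported in $G$ such that (i) $\mu_1$ and $\mu_2$ are shifts of $\lambda$, i.e. $\mu_j=\lambda*E_{x_j}$ for some $x_j\in X$, $j=1,2$, where $E_x$ is the degenerate distribution at $x$; (ii) $G$ is the minimal subgroup of $X$ containing the support of $\lambda$; (iii) $G=G_1\times G_2$ (internal direct product), where $G_1=(I+\alpha)(G)$ is a finite group and $G_2$ is a subgroup of $G$; (iv) $\lambda=m_{G_1}*\omega$, where $m_{G_1}$ is the Haar (i.e. uniform) distribution on the finite group $G_1$ and $\omega$ is a probability distribution supported in $G_2$; (v) if $\eta_1,\eta_2$ are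 independent identically distributed random variables with values in $X$ and distribution $\lambda$, then the conditional distribution of $M_2=\eta_1+\alpha\eta_2$ given $M_1=\eta_1+\eta_2$ is symmetric. -/

import Mathlib

open MeasureTheory ProbabilityTheory
open scoped DirectSum MeasureTheory

/-- The weak direct product (direct sum) of the cyclic groups `ℤ(p)`, where `p` runs over
the set `P` of natural numbers. It is considered in the discrete topology, and its Borel
`σ`-algebra therefore consists of all subsets. -/
def WeakProd (P : Set ℕ) : Type := ⨁ p : P, ZMod (p : ℕ)

namespace WeakProd

variable (P : Set ℕ)

instance : AddCommGroup (WeakProd P) :=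
  inferInstanceAs (AddCommGroup (⨁ p : P, ZMod (p : ℕ)))

instance : TopologicalSpace (WeakProd P) := ⊥

instance : DiscreteTopology (WeakProd P) := ⟨rfl⟩

instance : MeasurableSpace (WeakProd P) := ⊤

instance : DiscreteMeasurableSpace (WeakProd P) := ⟨fun _ => trivial⟩

instance : BorelSpace (WeakProd P) := ⟨borel_eq_top_of_discrete.symm⟩

instance : Countable (WeakProd P) := by
  have h : ∀ p : P, Countable (ZMod (p : ℕ)) := fun p => by
    rcases p with ⟨_ | n, hn⟩
    · exact inferInstanceAs (Countable ℤ)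
    · exact inferInstanceAs (Countable (Fin (n + 1)))
  classical
  exact inferInstanceAs (Countable (Π₀ p : P, ZMod (p : ℕ)))

end WeakProd

/-- The conditional distribution of `L₂` given `L₁` is symmetric: for almost every value `x`
of `L₁`, the conditional distribution of `L₂` given `L₁ = x` is invariant under `t ↦ -t`. -/
def CondSymmetric {Ω S X : Type*} [MeasurableSpace Ω] [MeasurableSpace S] [AddCommGroup X]
    [MeasurableSpace X] [StandardBorelSpace X] (L₂ : Ω → X) (L₁ : Ω → S)
    (ρ : Measure Ω) [IsFiniteMeasure ρ] : Prop :=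
  ∀ᵐ x ∂(ρ.map L₁), (condDistrib L₂ L₁ ρ x).map (fun t => -t) = condDistrib L₂ L₁ ρ x

/-- `μ` is a shift of `ν`, i.e. the convolution of `ν` with a degenerate distribution. -/
def IsShift {X : Type*} [AddCommGroup X] [MeasurableSpace X] (μ ν : Measure X) : Prop :=
  ∃ x : X, μ = ν ∗ Measure.dirac x

/-- The Haar distribution `m_K` of a finite subgroup `K`, as a distribution on the whole
group: the uniform distribution on `K`, giving mass `1 / |K|` to each element of `K`.
(In a discrete group the compact subgroups are exactly the finite ones; the value at an
infinite subgroup has no meaning.) -/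
noncomputable def haarDistribution {X : Type*} [AddCommGroup X] [MeasurableSpace X]
    (K : AddSubgroup X) : Measure X :=
  uniformOn (K : Set X)

/-!
The endomorphisms of the direct sum `X` of the groups `ℤ(p)` act on each factor separately, so `α`
multiplies the `p`-th coordinate by some `a p ≠ 0` (`WeakProd.exists_eq_coordMul`), and every
subgroup is stable under all endomorphisms (`WeakProd.mem_of_coord`). Conditional symmetry says
that `(L₁, L₂)` and `(L₁, -L₂)` have the same law
(`WeakProd.condSymmetric_iff_symmetricForms`).

On the factors with `a p = 1` this forces `L₁ = 0`, so both distributions are degenerate there.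
On the others `(u, v) ↦ (u + v, u + α v)` is injective, and the symmetry becomes
`μ₁{u} μ₂{v} = μ₁{u'} μ₂{v'}`, where `(u', v')` is a linear function of `(u, v)`
(`WeakProd.functional_equation`). Where `a p = -1` it exchanges `u` and `v`; where `a p ≠ ±1` all
four of its coefficients are units. This equation is preserved when `μ₁` and `μ₂` are shifted by
`α v` and `-v`; take `v` to be a point of maximal mass of `μ₂`.

The equation is then solved with the maximum principle, without characteristic functions. On the
sum `M` of the factors with `a p ≠ ±1`, the sets of maximum points are finite, and counting shows
that they are a single finite subgroup `H`; off `H` the masses vanish, since otherwise the largest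
of them would be smaller than itself (`exists_subgroup_of_functional_equation`). The same
equation across the cosets of `M` shows that the two shifted distributions coincide. Their common
value `lam` is `H`-invariant, and `(I + α)(supp lam) ⊆ H`
(`WeakProd.exists_finite_subgroup_of_symmetricForms`). So for `G` generated by `supp lam`, the
subgroup `(I + α)(G) ⊆ H` is finite, it is complemented in `G` by `G ∩ ker (I + α)`, and the
invariance gives the factorization of `lam` (`WeakProd.exists_decomposition`). The last assertion
is the symmetry of the shifted pair, which consists of two copies of `lam`.
-/

/-! ### A functional equation on abelian groups -/

section Uniform

variable {ι M : Type*} [AddCommGroup M]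

/-- The hypothesis says that `s` maps every cyclic subgroup onto a subgroup containing it. -/
lemma injective_of_exists_nsmul {s : M →+ M} (hs : ∀ d, ∃ n : ℕ, n • s d = d) :
    Function.Injective s := by
  rw [injective_iff_map_eq_zero]
  intro d hd
  obtain ⟨n, hn⟩ := hs d
  rw [← hn, hd, nsmul_zero]

lemma eq_one_of_mul_eq_one_of_le {x y : ℝ} (hx0 : 0 ≤ x) (hx : x ≤ 1) (hy : y ≤ 1)
    (h : x * y = 1) : x = 1 ∧ y = 1 := by
  have hx1 : x = 1 := by nlinarith
  exact ⟨hx1, by rwa [hx1, one_mul] at h⟩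

/-- The functional equation for functions with maximum `1`. The map
`(m, n) ↦ (s m + t n, q m + r n)` sends products of sets of maximum points to such products, and comparing cardinalities makes all
of these sets one finite subgroup `H`. Outside `H`, a point `n` of maximal value of `G k` would
give `G k n = F k (t n) * G k (r n) < G k n`, so the functions vanish there. -/
theorem exists_subgroup_of_normalized {s t q r : M →+ M}
    (ht : ∀ d, ∃ n : ℕ, n • t d = d)
    (hq : ∀ d, ∃ n : ℕ, n • q d = d) (hr : ∀ d, ∃ n : ℕ, n • r d = d)
    {F G : ι → M → ℝ} (hF0 : ∀ k m, 0 ≤ F k m) (hF1 : ∀ k m, F k m ≤ 1)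
    (hG0 : ∀ k m, 0 ≤ G k m) (hG1 : ∀ k m, G k m ≤ 1)
    (hFfin : ∀ k ε, 0 < ε → {m | ε ≤ F k m}.Finite)
    (hGfin : ∀ k ε, 0 < ε → {m | ε ≤ G k m}.Finite)
    (hFmax : ∀ k, ∃ m, F k m = 1) (hGmax : ∀ k, ∃ m, G k m = 1)
    (heq : ∀ k l m n, F k m * G l n = F l (s m + t n) * G k (q m + r n))
    {k₀ : ι} (h0 : G k₀ 0 = 1) :
    ∃ H : AddSubgroup M, Finite H ∧
      (∀ k, ∀ m ∈ H, F k m = 1 ∧ G k m = 1) ∧ (∀ k, ∀ m ∉ H, F k m = 0 ∧ G k m = 0) := by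
  have hAfin : ∀ k, {m | F k m = 1}.Finite := fun k =>
    (hFfin k 1 one_pos).subset fun m hm => ge_of_eq hm
  have hBfin : ∀ k, {m | G k m = 1}.Finite := fun k =>
    (hGfin k 1 one_pos).subset fun m hm => ge_of_eq hm
  have hmap : ∀ {k l m n}, F k m = 1 → G l n = 1 →
      F l (s m + t n) = 1 ∧ G k (q m + r n) = 1 := by
    intro k l m n hm hn
    refine eq_one_of_mul_eq_one_of_le (hF0 _ _) (hF1 _ _) (hG1 _ _) ?_
    rw [← heq, hm, hn, one_mul]
  have hle : ∀ l, {m | G l m = 1}.ncard ≤ {m | F l m = 1}.ncard := by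
    intro l
    obtain ⟨m, hm⟩ := hFmax l
    refine Set.ncard_le_ncard_of_injOn (fun n => s m + t n) (fun n hn => (hmap hm hn).1) ?_
      (hAfin l)
    exact ((add_right_injective (s m)).comp (injective_of_exists_nsmul ht)).injOn
  -- Every maximum point of `G k` has the form `q m + r n` with `n` prescribed,
  -- so changing `n` translates the set of maximum points of `G k`.
  have hBr : ∀ {k l₁ l₂ y n₁ n₂}, G k y = 1 → G l₁ n₁ = 1 → G l₂ n₂ = 1 →
      G k (y + r (n₂ - n₁)) = 1 := by
    intro k l₁ l₂ y n₁ n₂ hy h₁ h₂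
    obtain ⟨m, hm, hmy⟩ := Set.surj_on_of_inj_on_of_ncard_le
      (s := {m | F k m = 1}) (t := {m | G k m = 1}) (fun m _ => q m + r n₁)
      (fun m hm => (hmap hm h₁).2)
      (fun a b _ _ hab => injective_of_exists_nsmul hq (add_right_cancel hab)) (hle k) (hBfin k)
      y hy
    have := (hmap hm h₂).2
    rwa [show y + r (n₂ - n₁) = q m + r n₂ by rw [hmy, map_sub]; abel]
  have hB : ∀ {k l₁ l₂ y n₁ n₂}, G k y = 1 → G l₁ n₁ = 1 → G l₂ n₂ = 1 →
      G k (y + (n₂ - n₁)) = 1 := by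
    intro k l₁ l₂ y n₁ n₂ hy h₁ h₂
    obtain ⟨n, hn⟩ := hr (n₂ - n₁)
    rw [← hn]
    clear hn
    induction n with
    | zero => simpa using hy
    | succ n ih =>
      rw [succ_nsmul, ← add_assoc]
      exact hBr ih h₁ h₂
  let H : AddSubgroup M :=
    { carrier := {m | G k₀ m = 1}
      zero_mem' := h0
      add_mem' := fun {a b} ha hb => by simpa using hB ha h0 hb
      neg_mem' := fun {a} ha => by simpa using hB h0 ha h0 }
  have hHdef : ∀ {m}, m ∈ H ↔ G k₀ m = 1 := Iff.rfl
  have hBH : ∀ {k m}, G k m = 1 ↔ m ∈ H := by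
    intro k m
    have hk0 : G k 0 = 1 := by
      obtain ⟨n, hn⟩ := hGmax k
      simpa using hB hn hn h0
    exact ⟨fun h => hHdef.2 (by simpa using hB h0 hk0 h),
      fun h => by simpa using hB hk0 h0 (hHdef.1 h)⟩
  have hmemq : ∀ {m}, q m ∈ H → m ∈ H := fun {m} h => by
    obtain ⟨n, hn⟩ := hq m
    exact hn ▸ H.nsmul_mem h n
  have hmemr : ∀ {m}, r m ∈ H → m ∈ H := fun {m} h => by
    obtain ⟨n, hn⟩ := hr m
    exact hn ▸ H.nsmul_mem h n
  have hmemt : ∀ {m}, t m ∈ H → m ∈ H := fun {m} h => by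
    obtain ⟨n, hn⟩ := ht m
    exact hn ▸ H.nsmul_mem h n
  have hAH : ∀ {k m}, F k m = 1 ↔ m ∈ H := by
    intro k m
    have hsub : {m | F k m = 1} ⊆ {m | G k m = 1} := fun m hm =>
      hBH.2 (hmemq (hBH.1 (by simpa using (hmap hm h0).2)))
    have := Set.eq_of_subset_of_ncard_le hsub (hle k) (hBfin k)
    exact (Set.ext_iff.1 this m).trans hBH
  have hGzero : ∀ k, ∀ m ∉ H, G k m = 0 := by
    intro k m hm
    by_contra hne
    have hpos : 0 < G k m := (hG0 k m).lt_of_ne' hne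
    obtain ⟨n, ⟨hnH, hn⟩, hmax⟩ := Set.exists_max_image {n | n ∉ H ∧ G k m ≤ G k n} (G k)
      ((hGfin k _ hpos).subset fun n hn => hn.2) ⟨m, hm, le_rfl⟩
    have h1 : G k n = F k (t n) * G k (r n) := by
      have := heq k k 0 n
      rwa [hAH.2 H.zero_mem, one_mul, map_zero, map_zero, zero_add, zero_add] at this
    have h2 : F k (t n) < 1 := (hF1 _ _).lt_of_ne fun h => hnH (hmemt (hAH.1 h))
    have h3 : G k (r n) ≤ G k n := by
      by_cases h : G k m ≤ G k (r n)
      · exact hmax _ ⟨fun h' => hnH (hmemr h'), h⟩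
      · exact (not_le.1 h).le.trans hn
    nlinarith [hF0 k (t n), hG0 k (r n)]
  refine ⟨H, (hBfin k₀).to_subtype, fun k m hm => ⟨hAH.2 hm, hBH.2 hm⟩,
    fun k m hm => ⟨?_, hGzero k m hm⟩⟩
  have := heq k k m 0
  rwa [hBH.2 H.zero_mem, mul_one, map_zero, map_zero, add_zero, add_zero,
    hGzero k (q m) (fun h => hm (hmemq h)), mul_zero] at this

lemma exists_max_of_finite_superlevel {M : Type*} {f : M → ℝ}
    (hfin : ∀ ε, 0 < ε → {m | ε ≤ f m}.Finite)
    (hne : ∃ m, 0 < f m) : ∃ x, 0 < f x ∧ ∀ m, f m ≤ f x := by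
  obtain ⟨m, hm⟩ := hne
  obtain ⟨x, hx, hmax⟩ := Set.exists_max_image _ f (hfin _ hm) ⟨m, le_refl (f m)⟩
  refine ⟨x, hm.trans_le hx, fun y => ?_⟩
  by_cases h : f m ≤ f y
  · exact hmax y h
  · exact (not_le.1 h).le.trans hx

/-- The families `F` and `G` are constant multiples of the indicator of one finite subgroup, and
the constants are proportional. The equation, evaluated at maximum points, gives
`φ k * ψ l ≤ φ l * ψ k` for the maxima; exchanging `k` and `l` gives equality, so one may divide
by the maxima. -/
theorem exists_subgroup_of_functional_equation {s t q r : M →+ M}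
    (ht : ∀ d, ∃ n : ℕ, n • t d = d)
    (hq : ∀ d, ∃ n : ℕ, n • q d = d) (hr : ∀ d, ∃ n : ℕ, n • r d = d)
    {F G : ι → M → ℝ} (hF0 : ∀ k m, 0 ≤ F k m) (hG0 : ∀ k m, 0 ≤ G k m)
    (hFfin : ∀ k ε, 0 < ε → {m | ε ≤ F k m}.Finite)
    (hGfin : ∀ k ε, 0 < ε → {m | ε ≤ G k m}.Finite)
    (hFne : ∀ k, ∃ m, 0 < F k m) (hGne : ∀ k, ∃ m, 0 < G k m)
    (heq : ∀ k l m n, F k m * G l n = F l (s m + t n) * G k (q m + r n))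
    {k₀ : ι} (h0 : ∀ m, G k₀ m ≤ G k₀ 0) :
    ∃ (H : AddSubgroup M) (φ ψ : ι → ℝ), Finite H ∧
      (∀ k l, φ k * ψ l = φ l * ψ k) ∧
      (∀ k, ∀ m ∈ H, F k m = φ k ∧ G k m = ψ k) ∧ (∀ k, ∀ m ∉ H, F k m = 0 ∧ G k m = 0) := by
  choose x hxpos hxmax using fun k => exists_max_of_finite_superlevel (hFfin k) (hFne k)
  choose y hypos hymax using fun k => exists_max_of_finite_superlevel (hGfin k) (hGne k)
  have hφψle : ∀ k l, F k (x k) * G l (y l) ≤ F l (x l) * G k (y k) := fun k l =>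
    (heq k l (x k) (y l)).le.trans
      (mul_le_mul (hxmax _ _) (hymax _ _) (hG0 _ _) (hxpos l).le)
  have hφψ : ∀ k l, F k (x k) * G l (y l) = F l (x l) * G k (y k) := fun k l =>
    le_antisymm (hφψle k l) (hφψle l k)
  obtain ⟨H, hH, h1, h2⟩ := exists_subgroup_of_normalized (s := s) (k₀ := k₀)
    (F := fun k m => F k m / F k (x k)) (G := fun k m => G k m / G k (y k)) ht hq hr
    (fun k m => div_nonneg (hF0 _ _) (hF0 _ _))
    (fun k m => div_le_one_of_le₀ (hxmax _ _) (hF0 _ _))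
    (fun k m => div_nonneg (hG0 _ _) (hG0 _ _))
    (fun k m => div_le_one_of_le₀ (hymax _ _) (hG0 _ _))
    (fun k ε hε => by
      simpa only [le_div_iff₀ (hxpos k)] using hFfin k _ (mul_pos hε (hxpos k)))
    (fun k ε hε => by
      simpa only [le_div_iff₀ (hypos k)] using hGfin k _ (mul_pos hε (hypos k)))
    (fun k => ⟨x k, div_self (hxpos k).ne'⟩) (fun k => ⟨y k, div_self (hypos k).ne'⟩)
    (fun k l m n => by rw [div_mul_div_comm, div_mul_div_comm, heq k l, hφψ k l])
    (by
      rw [div_eq_one_iff_eq (hypos _).ne']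
      exact le_antisymm (hymax _ _) (h0 _))
  refine ⟨H, fun k => F k (x k), fun k => G k (y k), hH, hφψ, fun k m hm => ?_, fun k m hm => ?_⟩
  · have := h1 k m hm
    rwa [div_eq_one_iff_eq (hypos _).ne', div_eq_one_iff_eq (hxpos _).ne'] at this
  · have := h2 k m hm
    simpa [div_eq_zero_iff, (hypos k).ne', (hxpos k).ne'] using this

end Uniform

/-! ### Coordinates and endomorphisms of the weak direct product -/

namespace WeakProd

variable {P : Set ℕ}

/-- The projection of the weak direct product onto its `p`-th factor. -/
noncomputable def coord (p : P) : WeakProd P →+ ZMod (p : ℕ) :=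
  DFinsupp.evalAddMonoidHom (β := fun p : P => ZMod (p : ℕ)) p

/-- The element whose `p`-th coordinate is `z` and whose other coordinates vanish. -/
noncomputable def single (p : P) : ZMod (p : ℕ) →+ WeakProd P := by
  classical
  exact DFinsupp.singleAddHom (fun p : P => ZMod (p : ℕ)) p

/-- Multiplication of the `p`-th coordinate by `b p`, for every `p`. -/
noncomputable def coordMul (b : (p : P) → ZMod (p : ℕ)) : WeakProd P →+ WeakProd P :=
  DFinsupp.mapRange.addMonoidHom (β₁ := fun p : P => ZMod (p : ℕ))
    (β₂ := fun p : P => ZMod (p : ℕ)) fun p => AddMonoidHom.mulLeft (b p)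

@[ext]
lemma ext_coord {x y : WeakProd P} (h : ∀ p, coord p x = coord p y) : x = y :=
  DFinsupp.ext h

@[simp]
lemma coord_coordMul (b : (p : P) → ZMod (p : ℕ)) (x : WeakProd P) (p : P) :
    coord p (coordMul b x) = b p * coord p x :=
  DFinsupp.mapRange_apply (β₁ := fun p : P => ZMod (p : ℕ)) (β₂ := fun p : P => ZMod (p : ℕ))
    _ (fun _ => mul_zero _) x p

@[simp]
lemma coord_single_same (p : P) (z : ZMod (p : ℕ)) : coord p (single p z) = z := by
  classical
  exact DFinsupp.single_eq_same (β := fun p : P => ZMod (p : ℕ))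

lemma coord_single_of_ne {p q : P} (h : q ≠ p) (z : ZMod (p : ℕ)) : coord q (single p z) = 0 := by
  classical
  exact DFinsupp.single_eq_of_ne (β := fun p : P => ZMod (p : ℕ)) h

lemma finite_support_coord (x : WeakProd P) : {p | coord p x ≠ 0}.Finite := by
  classical
  refine (DFinsupp.support (β := fun p : P => ZMod (p : ℕ)) x).finite_toSet.subset fun p hp => ?_
  exact (DFinsupp.mem_support_iff (β := fun p : P => ZMod (p : ℕ))).2 hp

/-- By the Chinese remainder theorem, every element whose support is contained in that of `x`
is a multiple of `x`. -/
lemma exists_nsmul_eq (hP : ∀ p ∈ P, p.Prime) {x y : WeakProd P}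
    (h : ∀ p, coord p x = 0 → coord p y = 0) : ∃ n : ℕ, n • x = y := by
  classical
  let S := (finite_support_coord x).toFinset
  obtain ⟨n, hn⟩ := Nat.chineseRemainderOfFinset
    (fun p : P => (coord p y * (coord p x)⁻¹).val) (fun p : P => (p : ℕ)) S
    (fun p _ => (hP p p.2).ne_zero)
    (fun p _ q _ hpq => (Nat.coprime_primes (hP p p.2) (hP q q.2)).2 fun h => hpq (Subtype.ext h))
  refine ⟨n, ext_coord fun p => ?_⟩
  have : Fact (p : ℕ).Prime := ⟨hP p p.2⟩
  rw [map_nsmul, nsmul_eq_mul]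
  by_cases hp : coord p x = 0
  · rw [hp, h p hp, mul_zero]
  · have := hn p (by simpa [S] using hp)
    rw [← ZMod.natCast_eq_natCast_iff, ZMod.natCast_zmod_val] at this
    rw [this, mul_assoc, inv_mul_cancel₀ hp, mul_one]

lemma mem_of_coord (hP : ∀ p ∈ P, p.Prime) {H : AddSubgroup (WeakProd P)} {x y : WeakProd P}
    (hx : x ∈ H) (h : ∀ p, coord p x = 0 → coord p y = 0) : y ∈ H := by
  obtain ⟨n, rfl⟩ := exists_nsmul_eq hP h
  exact H.nsmul_mem hx n

/-- An endomorphism acts on each coordinate separately. -/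
lemma exists_eq_coordMul (hP : ∀ p ∈ P, p.Prime) (f : WeakProd P →+ WeakProd P) :
    ∃ a : (p : P) → ZMod (p : ℕ), f = coordMul a := by
  classical
  -- The order of an element with `p`-th coordinate zero is prime to `p`.
  have key : ∀ (x : WeakProd P) (p : P), coord p x = 0 → coord p (f x) = 0 := by
    intro x p hp
    have : Fact (p : ℕ).Prime := ⟨hP p p.2⟩
    let S := (finite_support_coord x).toFinset
    have hx : (∏ q ∈ S, (q : ℕ)) • x = 0 := by
      refine ext_coord fun q => ?_
      rw [map_nsmul, map_zero, nsmul_eq_mul]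
      by_cases hq : coord q x = 0
      · rw [hq, mul_zero]
      · have hqS : q ∈ S := by simpa [S] using hq
        rw [(ZMod.natCast_eq_zero_iff _ _).2 (Finset.dvd_prod_of_mem _ hqS), zero_mul]
    have h1 := congrArg (coord p) (congrArg f hx)
    rw [map_nsmul, map_nsmul, map_zero, map_zero, nsmul_eq_mul] at h1
    refine (mul_eq_zero.1 h1).resolve_left fun h2 => ?_
    rw [ZMod.natCast_eq_zero_iff, (hP p p.2).prime.dvd_finsetProd_iff] at h2
    obtain ⟨q, hq, hpq⟩ := h2
    have : p = q := Subtype.ext ((Nat.prime_dvd_prime_iff_eq (hP p p.2) (hP q q.2)).1 hpq)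
    subst this
    simp [S, hp] at hq
  refine ⟨fun p => coord p (f (single p 1)), AddMonoidHom.ext fun x => ext_coord fun p => ?_⟩
  have : Fact (p : ℕ).Prime := ⟨hP p p.2⟩
  have h1 := key (x - single p (coord p x)) p (by simp)
  have h2 : single p (coord p x) = (coord p x).val • single p (1 : ZMod (p : ℕ)) := by
    rw [← map_nsmul, nsmul_one, ZMod.natCast_zmod_val]
  rw [map_sub, map_sub, sub_eq_zero] at h1
  rw [h1, h2, map_nsmul, map_nsmul, nsmul_eq_mul, ZMod.natCast_zmod_val, coord_coordMul, mul_comm]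

/-- The coordinates of an automorphism are units. -/
lemma coord_ne_zero_of_injective (hP : ∀ p ∈ P, p.Prime) {a : (p : P) → ZMod (p : ℕ)}
    (ha : Function.Injective (coordMul a)) (p : P) : a p ≠ 0 := by
  intro h
  have : Fact (p : ℕ).Prime := ⟨hP p p.2⟩
  have h1 : coordMul a (single p 1) = 0 := by
    refine ext_coord fun q => ?_
    by_cases hq : q = p
    · subst hq; simp [h]
    · simp [coord_single_of_ne hq]
  have h2 := congrArg (coord p) ((map_eq_zero_iff _ ha).1 h1)
  simp at h2

end WeakProd

/-! ### Conditional symmetry as an identity of joint laws -/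

/-- Both the conditional distribution and its reflection are disintegrations of joint laws, so
they agree almost everywhere if and only if the joint laws do. -/
lemma condSymmetric_iff_map_eq {Ω S X : Type*} [MeasurableSpace Ω] [MeasurableSpace S]
    [AddCommGroup X] [MeasurableSpace X] [StandardBorelSpace X] [MeasurableNeg X]
    {L₂ : Ω → X} {L₁ : Ω → S} {ρ : Measure Ω} [IsFiniteMeasure ρ]
    (h₁ : Measurable L₁) (h₂ : Measurable L₂) :
    CondSymmetric L₂ L₁ ρ ↔
      ρ.map (fun w => (L₁ w, L₂ w)) = ρ.map (fun w => (L₁ w, -L₂ w)) := by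
  have hneg : Measurable fun t : X => -t := measurable_neg
  have key : ρ.map L₁ ⊗ₘ (condDistrib L₂ L₁ ρ).map (fun t => -t)
      = ρ.map (fun w => (L₁ w, -L₂ w)) := by
    rw [Measure.compProd_map hneg, compProd_map_condDistrib h₂.aemeasurable,
      Measure.map_map (by fun_prop) (by fun_prop)]
    rfl
  rw [← key, ← condDistrib_ae_eq_iff_measure_eq_compProd L₁ h₂.aemeasurable]
  refine ⟨fun h => ?_, fun h => ?_⟩ <;> filter_upwards [h] with x hx
  · rw [Kernel.map_apply _ hneg, hx]
  · rw [Kernel.map_apply _ hneg] at hx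
    exact hx.symm

/-- The joint law of `ξ₁ + ξ₂` and `ξ₁ + α ξ₂`, for independent `ξ₁`, `ξ₂` with laws
`μ₁`, `μ₂`, does not change when the second component is multiplied by `-1`. -/
def SymmetricForms {P : Set ℕ} (α : WeakProd P →+ WeakProd P)
    (μ₁ μ₂ : Measure (WeakProd P)) : Prop :=
  (μ₁.prod μ₂).map (fun z => (z.1 + z.2, z.1 + α z.2)) =
    (μ₁.prod μ₂).map (fun z => (z.1 + z.2, -(z.1 + α z.2)))

lemma SymmetricForms.shift {P : Set ℕ} {α : WeakProd P →+ WeakProd P}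
    {μ₁ μ₂ : Measure (WeakProd P)} [IsProbabilityMeasure μ₁] [IsProbabilityMeasure μ₂]
    (h : SymmetricForms α μ₁ μ₂)
    (v : WeakProd P) :
    SymmetricForms α (μ₁.map (· + α v)) (μ₂.map (· - v)) := by
  have hd : ∀ f : WeakProd P × WeakProd P → WeakProd P × WeakProd P, Measurable f :=
    fun _ => .of_discrete
  unfold SymmetricForms at *
  have h' := congrArg (Measure.map fun z => (z.1 + (α v - v), z.2)) h
  rw [Measure.map_map (hd _) (hd _), Measure.map_map (hd _) (hd _)] at h'
  rw [Measure.map_prod_map _ _ .of_discrete .of_discrete, Measure.map_map (hd _) (hd _),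
    Measure.map_map (hd _) (hd _)]
  convert h' using 2 <;> ext z : 2 <;> simp <;> abel

namespace WeakProd

variable {P : Set ℕ}

lemma condSymmetric_iff_symmetricForms {α : WeakProd P →+ WeakProd P} {Ω : Type*}
    [MeasurableSpace Ω] {ρ : Measure Ω} [IsProbabilityMeasure ρ] {ξ₁ ξ₂ : Ω → WeakProd P}
    (hξ₁ : Measurable ξ₁) (hξ₂ : Measurable ξ₂) (hindep : IndepFun ξ₁ ξ₂ ρ) :
    CondSymmetric (fun w => ξ₁ w + α (ξ₂ w)) (fun w => ξ₁ w + ξ₂ w) ρ ↔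
      SymmetricForms α (ρ.map ξ₁) (ρ.map ξ₂) := by
  have hα : Measurable α := .of_discrete
  rw [condSymmetric_iff_map_eq (by fun_prop) (by fun_prop), SymmetricForms,
    ← (indepFun_iff_map_prod_eq_prod_map_map hξ₁.aemeasurable hξ₂.aemeasurable).1 hindep,
    Measure.map_map .of_discrete (by fun_prop), Measure.map_map .of_discrete (by fun_prop)]
  rfl

lemma measureReal_prod_singleton {μ₁ μ₂ : Measure (WeakProd P)} [IsProbabilityMeasure μ₁]
    [IsProbabilityMeasure μ₂] (u v : WeakProd P) :
    (μ₁.prod μ₂).real {(u, v)} = μ₁.real {u} * μ₂.real {v} := by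
  rw [← Set.singleton_prod_singleton, measureReal_prod_prod]

lemma exists_of_ne_zero {μ : Measure (WeakProd P × WeakProd P)}
    {s : Set (WeakProd P × WeakProd P)} (h : μ s ≠ 0) : ∃ z ∈ s, μ {z} ≠ 0 := by
  by_contra! hc
  refine h ?_
  rw [← Set.biUnion_of_singleton s]
  exact (measure_biUnion_null_iff s.to_countable).2 hc

lemma finite_superlevel (μ : Measure (WeakProd P)) [IsProbabilityMeasure μ] {ε : ℝ} (hε : 0 < ε) :
    {x | ε ≤ μ.real {x}}.Finite := by
  have hsum : ∑' x, μ {x} ≠ ⊤ := by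
    have := Measure.tsum_indicator_apply_singleton μ Set.univ MeasurableSet.univ
    simp only [Set.indicator_univ, measure_univ] at this
    simp [this]
  have := (ENNReal.summable_toReal hsum).tendsto_cofinite_zero
  have h2 := this.eventually (gt_mem_nhds hε)
  rw [Filter.eventually_cofinite] at h2
  simpa only [not_lt, ← measureReal_def] using h2

lemma tsum_measureReal_singleton (μ : Measure (WeakProd P)) [IsProbabilityMeasure μ] :
    ∑' x, μ.real {x} = 1 := by
  have := Measure.tsum_indicator_apply_singleton μ Set.univ MeasurableSet.univ
  simp only [Set.indicator_univ, measure_univ] at this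
  simp only [measureReal_def]
  rw [← ENNReal.tsum_toReal_eq (by simp), this, ENNReal.toReal_one]

lemma two_ne_zero_of_mem (hP : ∀ p ∈ P, p.Prime) (h2 : 2 ∉ P) (p : P) :
    (2 : ZMod (p : ℕ)) ≠ 0 := by
  have hp2 : (p : ℕ) ≠ 2 := fun h => h2 (h ▸ p.2)
  intro h
  have h' : ((2 : ℕ) : ZMod (p : ℕ)) = 0 := by exact_mod_cast h
  rw [ZMod.natCast_eq_zero_iff] at h'
  exact hp2 ((Nat.prime_dvd_prime_iff_eq (hP p p.2) Nat.prime_two).1 h')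

/-- On a factor where `α` is the identity, `L₁` and `L₂` coincide. Given `L₁`, the form `L₂` is
then a constant with a symmetric distribution, which is `0` as the factor has odd order. -/
lemma coord_eq_zero_of_symmetricForms (hP : ∀ p ∈ P, p.Prime) (h2 : 2 ∉ P)
    {a : (p : P) → ZMod (p : ℕ)}
    {ν₁ ν₂ : Measure (WeakProd P)} [IsProbabilityMeasure ν₁] [IsProbabilityMeasure ν₂]
    (hsym : SymmetricForms (coordMul a) ν₁ ν₂) {u v : WeakProd P}
    (hu : ν₁.real {u} ≠ 0) (hv : ν₂.real {v} ≠ 0) {p : P} (hp : a p = 1) :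
    coord p u + coord p v = 0 := by
  have h2p := two_ne_zero_of_mem hP h2 p
  have : Fact (p : ℕ).Prime := ⟨hP p p.2⟩
  have h := congrArg (fun m => m {(u + v, u + coordMul a v)}) hsym
  simp only [Measure.map_apply (Measurable.of_discrete (f := _)) (MeasurableSet.singleton _)] at h
  have hne : (ν₁.prod ν₂)
      ((fun z : WeakProd P × WeakProd P => (z.1 + z.2, z.1 + coordMul a z.2)) ⁻¹'
        {(u + v, u + coordMul a v)}) ≠ 0 := by
    intro h0
    have h1 : (ν₁.prod ν₂) {(u, v)} = 0 := measure_mono_null (by simp) h0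
    have h3 := measureReal_prod_singleton (μ₁ := ν₁) (μ₂ := ν₂) u v
    rw [measureReal_def, h1, ENNReal.toReal_zero] at h3
    exact mul_ne_zero hu hv h3.symm
  rw [h] at hne
  obtain ⟨z, hz, -⟩ := exists_of_ne_zero hne
  simp only [Set.mem_preimage, Set.mem_singleton_iff, Prod.mk.injEq] at hz
  have e1 := congrArg (coord p) hz.1
  have e2 := congrArg (coord p) hz.2
  simp only [map_add, map_neg, coord_coordMul, hp, one_mul] at e1 e2
  have : 2 * (coord p u + coord p v) = 0 := by linear_combination -e1 - e2
  exact (mul_eq_zero.1 this).resolve_left h2p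

lemma measure_eq_measure_singleton {μ : Measure (WeakProd P × WeakProd P)}
    {s : Set (WeakProd P × WeakProd P)} {z : WeakProd P × WeakProd P} (hz : z ∈ s)
    (h : ∀ w ∈ s, μ {w} ≠ 0 → w = z) : μ s = μ {z} := by
  refine le_antisymm ?_ (measure_mono (Set.singleton_subset_iff.2 hz))
  have h0 : μ (s \ {z}) = 0 := by
    by_contra hne
    obtain ⟨w, hw, hw0⟩ := exists_of_ne_zero hne
    exact hw.2 (h w hw.1 hw0)
  calc μ s ≤ μ ({z} ∪ s \ {z}) := measure_mono fun w hw => by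
        by_cases h : w = z
        · exact Or.inl h
        · exact Or.inr ⟨hw, h⟩
    _ ≤ μ {z} + μ (s \ {z}) := measure_union_le _ _
    _ = μ {z} := by rw [h0, add_zero]

/-- On the elements which vanish in the coordinates with `a p = 1` the linear forms `L₁` and
`L₂` determine `(u, v)`, and so the symmetry of their joint law is an identity between single
products of point masses. -/
lemma functional_equation (hP : ∀ p ∈ P, p.Prime) {a : (p : P) → ZMod (p : ℕ)}
    {ν₁ ν₂ : Measure (WeakProd P)} [IsProbabilityMeasure ν₁] [IsProbabilityMeasure ν₂]
    (hsym : SymmetricForms (coordMul a) ν₁ ν₂)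
    (hN₁ : ∀ u, ν₁.real {u} ≠ 0 → ∀ p, a p = 1 → coord p u = 0)
    (hN₂ : ∀ u, ν₂.real {u} ≠ 0 → ∀ p, a p = 1 → coord p u = 0)
    {u v u' v' : WeakProd P}
    (hu : ∀ p, a p = 1 → coord p u = 0) (hv : ∀ p, a p = 1 → coord p v = 0)
    (hu' : ∀ p, a p = 1 → coord p u' = 0) (hv' : ∀ p, a p = 1 → coord p v' = 0)
    (h₁ : u' + v' = u + v) (h₂ : u' + coordMul a v' = -(u + coordMul a v)) :
    ν₁.real {u} * ν₂.real {v} = ν₁.real {u'} * ν₂.real {v'} := by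
  have hN : ∀ w, (ν₁.prod ν₂) {w} ≠ 0 → ∀ p, a p = 1 → coord p w.1 = 0 ∧ coord p w.2 = 0 := by
    intro w hw p hp
    have hw' : (ν₁.prod ν₂).real {(w.1, w.2)} ≠ 0 :=
      ENNReal.toReal_ne_zero.2 ⟨hw, measure_ne_top _ _⟩
    rw [measureReal_prod_singleton] at hw'
    exact ⟨hN₁ _ (left_ne_zero_of_mul hw') p hp, hN₂ _ (right_ne_zero_of_mul hw') p hp⟩
  -- Two linear forms with coefficients `1, 1` and `1, a p` determine the `p`-th coordinates
  -- whenever `a p ≠ 1`.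
  have hinj : ∀ {x y x' y' : WeakProd P}, (∀ p, a p = 1 → coord p x = 0) →
      (∀ p, a p = 1 → coord p y = 0) → (∀ p, a p = 1 → coord p x' = 0) →
      (∀ p, a p = 1 → coord p y' = 0) → x + y = x' + y' →
      x + coordMul a y = x' + coordMul a y' → (x, y) = (x', y') := by
    intro x y x' y' hx hy hx' hy' e₁ e₂
    have hy2 : y = y' := by
      refine ext_coord fun p => ?_
      have : Fact (p : ℕ).Prime := ⟨hP p p.2⟩
      by_cases hp : a p = 1
      · rw [hy p hp, hy' p hp]
      · have c₁ := congrArg (coord p) e₁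
        have c₂ := congrArg (coord p) e₂
        simp only [map_add, coord_coordMul] at c₁ c₂
        have : (1 - a p) * (coord p y - coord p y') = 0 := by linear_combination c₁ - c₂
        exact sub_eq_zero.1 ((mul_eq_zero.1 this).resolve_left (sub_ne_zero.2 (Ne.symm hp)))
    subst hy2
    rw [add_right_cancel e₁]
  have h := congrArg (fun m => m {(u + v, -(u + coordMul a v))}) hsym
  simp only [Measure.map_apply (Measurable.of_discrete (f := _)) (MeasurableSet.singleton _)] at h
  have e₁ := measure_eq_measure_singleton (μ := ν₁.prod ν₂) (z := (u', v'))
    (s := (fun z : WeakProd P × WeakProd P => (z.1 + z.2, z.1 + coordMul a z.2)) ⁻¹'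
      {(u + v, -(u + coordMul a v))}) (by simp [h₁, h₂]) fun w hw hw0 => by
    simp only [Set.mem_preimage, Set.mem_singleton_iff, Prod.mk.injEq] at hw
    exact hinj (fun p hp => (hN w hw0 p hp).1) (fun p hp => (hN w hw0 p hp).2) hu' hv'
      (hw.1.trans h₁.symm) (hw.2.trans h₂.symm)
  have e₂ := measure_eq_measure_singleton (μ := ν₁.prod ν₂) (z := (u, v))
    (s := (fun z : WeakProd P × WeakProd P => (z.1 + z.2, -(z.1 + coordMul a z.2))) ⁻¹'
      {(u + v, -(u + coordMul a v))}) (by simp) fun w hw hw0 => by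
    simp only [Set.mem_preimage, Set.mem_singleton_iff, Prod.mk.injEq, neg_inj] at hw
    exact hinj (fun p hp => (hN w hw0 p hp).1) (fun p hp => (hN w hw0 p hp).2) hu hv hw.1 hw.2
  rw [← measureReal_prod_singleton, ← measureReal_prod_singleton, measureReal_def,
    measureReal_def, ← e₂, ← h, e₁]

/-! ### Structure of the symmetric pairs -/

/-- The subgroup of the elements whose coordinates with index in `Q` are zero. -/
def vanishing (Q : Set P) : AddSubgroup (WeakProd P) where
  carrier := {x | ∀ p ∈ Q, coord p x = 0}
  zero_mem' := fun p _ => map_zero _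
  add_mem' := fun {x y} hx hy p hp => by rw [map_add, hx p hp, hy p hp, add_zero]
  neg_mem' := fun {x} hx p hp => by rw [map_neg, hx p hp, neg_zero]

/-- The restriction of `coordMul b` to `vanishing Q`. -/
noncomputable def coordMulOn (Q : Set P) (b : (p : P) → ZMod (p : ℕ)) :
    vanishing Q →+ vanishing Q :=
  ((coordMul b).comp (vanishing Q).subtype).codRestrict (vanishing Q) fun x p hp => by
    simp [x.2 p hp]

@[simp]
lemma coord_coordMulOn (Q : Set P) (b : (p : P) → ZMod (p : ℕ)) (x : vanishing Q) (p : P) :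
    coord p (coordMulOn Q b x : WeakProd P) = b p * coord p (x : WeakProd P) :=
  coord_coordMul b x p

lemma exists_nsmul_coordMulOn_eq (hP : ∀ p ∈ P, p.Prime) {Q : Set P}
    {b : (p : P) → ZMod (p : ℕ)} (hb : ∀ p ∉ Q, b p ≠ 0) (x : vanishing Q) :
    ∃ n : ℕ, n • coordMulOn Q b x = x := by
  obtain ⟨n, hn⟩ := exists_nsmul_eq hP (x := (coordMulOn Q b x : WeakProd P)) (y := x)
    fun p hp => by
      have : Fact (p : ℕ).Prime := ⟨hP p p.2⟩
      by_cases hpQ : p ∈ Q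
      · exact x.2 p hpQ
      · rw [coord_coordMulOn] at hp
        exact (mul_eq_zero.1 hp).resolve_left (hb p hpQ)
  exact ⟨n, Subtype.ext (by simpa using hn)⟩

lemma exists_measureReal_singleton_ne_zero (μ : Measure (WeakProd P)) [IsProbabilityMeasure μ] :
    ∃ x, μ.real {x} ≠ 0 := by
  by_contra! h
  have := tsum_measureReal_singleton μ
  simp [h] at this

/-- If a maximal mass of `ν₂` is at the origin, then `ν₁ = ν₂`, and this distribution is
invariant under a finite subgroup `H` which contains `(I + α)x` for all `x` in its support. -/
theorem exists_finite_subgroup_of_symmetricForms (hP : ∀ p ∈ P, p.Prime) (h2 : 2 ∉ P)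
    {a : (p : P) → ZMod (p : ℕ)} (ha : ∀ p, a p ≠ 0)
    {ν₁ ν₂ : Measure (WeakProd P)} [IsProbabilityMeasure ν₁] [IsProbabilityMeasure ν₂]
    (hsym : SymmetricForms (coordMul a) ν₁ ν₂) (hmax : ∀ x, ν₂.real {x} ≤ ν₂.real {0}) :
    ν₁ = ν₂ ∧ ∃ H : AddSubgroup (WeakProd P), Finite H ∧
      (∀ d ∈ H, ∀ x, ν₂.real {x + d} = ν₂.real {x}) ∧
      ∀ x, ν₂.real {x} ≠ 0 → x + coordMul a x ∈ H := by
  classical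
  have h0 : ν₂.real {0} ≠ 0 := by
    obtain ⟨x, hx⟩ := exists_measureReal_singleton_ne_zero ν₂
    exact fun h => hx (le_antisymm (h ▸ hmax x) measureReal_nonneg)
  obtain ⟨u₀, hu₀⟩ := exists_measureReal_singleton_ne_zero ν₁
  have hN₁ : ∀ u, ν₁.real {u} ≠ 0 → ∀ p, a p = 1 → coord p u = 0 := fun u hu p hp => by
    simpa using coord_eq_zero_of_symmetricForms hP h2 hsym hu h0 hp
  have hN₂ : ∀ u, ν₂.real {u} ≠ 0 → ∀ p, a p = 1 → coord p u = 0 := fun u hu p hp => by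
    simpa [hN₁ u₀ hu₀ p hp] using coord_eq_zero_of_symmetricForms hP h2 hsym hu₀ hu hp
  -- The group is the product of the factors with `a p = 1`, of the factors with `a p = -1` (the
  -- subgroup `K`) and of the remaining ones (the subgroup `vanishing Q`).
  let Q : Set P := {p | a p = 1 ∨ a p = -1}
  let K : AddSubgroup (WeakProd P) := vanishing {p | a p ≠ -1}
  have hne : ∀ p : P, (1 : ZMod (p : ℕ)) ≠ -1 := fun p h =>
    two_ne_zero_of_mem hP h2 p (by linear_combination h)
  have hdecomp : ∀ x : WeakProd P, (∀ p, a p = 1 → coord p x = 0) →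
      ∃ k ∈ K, ∃ m : vanishing Q, x = k + m := by
    intro x hx
    let κ : (p : P) → ZMod (p : ℕ) := fun p => if a p = -1 then 1 else 0
    refine ⟨coordMul κ x, fun p hp => ?_, ⟨x - coordMul κ x, fun p hp => ?_⟩, by simp⟩
    · simp [κ, show a p ≠ -1 from hp]
    · rcases hp with hp | hp
      · simp [hx p hp]
      · simp [κ, hp]
  have hzero : ∀ k ∈ K, ∀ m : vanishing Q, ∀ p, a p = 1 → coord p (k + m) = 0 := by
    intro k hk m p hp
    rw [map_add, hk p (by rw [Set.mem_ofPred_eq, hp]; exact hne p), m.2 p (Or.inl hp), add_zero]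
  -- Solving `u' + v' = u + v`, `u' + a v' = -(u + a v)` on a factor with `a ≠ ±1` gives
  -- `u' = s u + t v`, `v' = q u + r v`; on a factor with `a = -1` the solution is
  -- `u' = v`, `v' = u`.
  let c : (p : P) → ZMod (p : ℕ) := fun p => (1 - a p)⁻¹
  let s := coordMulOn Q fun p => -(c p * (1 + a p))
  let t := coordMulOn Q fun p => -(2 * c p * a p)
  let q := coordMulOn Q fun p => 2 * c p
  let r := coordMulOn Q fun p => c p * (1 + a p)
  have heq : ∀ k ∈ K, ∀ l ∈ K, ∀ m n : vanishing Q,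
      ν₁.real {k + m} * ν₂.real {l + n} =
        ν₁.real {l + (s m + t n : vanishing Q)} * ν₂.real {k + (q m + r n : vanishing Q)} := by
    intro k hk l hl m n
    refine functional_equation hP hsym hN₁ hN₂ (hzero k hk m) (hzero l hl n)
      (hzero l hl _) (hzero k hk _) ?_ ?_ <;> refine ext_coord fun p => ?_ <;>
      have : Fact (p : ℕ).Prime := ⟨hP p p.2⟩ <;>
      simp only [map_add, map_neg, coord_coordMul, AddSubgroup.coe_add, s, t, q, r,
        coord_coordMulOn] <;> by_cases hp : p ∈ Q
    · rw [m.2 p hp, n.2 p hp]; ring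
    · have hc : c p * (1 - a p) = 1 :=
        inv_mul_cancel₀ (sub_ne_zero.2 fun h => hp (Or.inl h.symm))
      linear_combination (coord p (m : WeakProd P) + coord p (n : WeakProd P)) * hc
    · rw [m.2 p hp, n.2 p hp]
      rcases hp with hp | hp
      · rw [hk p (by rw [Set.mem_ofPred_eq, hp]; exact hne p),
          hl p (by rw [Set.mem_ofPred_eq, hp]; exact hne p)]; ring
      · rw [hp]; ring
    · have hc : c p * (1 - a p) = 1 :=
        inv_mul_cancel₀ (sub_ne_zero.2 fun h => hp (Or.inl h.symm))
      rw [hk p fun h => hp (Or.inr h), hl p fun h => hp (Or.inr h)]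
      linear_combination (-coord p (m : WeakProd P) - a p * coord p (n : WeakProd P)) * hc
  have hpos : ∀ {μ : Measure (WeakProd P)} {x}, μ.real {x} ≠ 0 → 0 < μ.real {x} :=
    fun h => measureReal_nonneg.lt_of_ne' h
  -- Translates of `vanishing Q` by elements of `K` are charged by `ν₁` if and only if they are
  -- charged by `ν₂`.
  let ι := {k : WeakProd P // k ∈ K ∧ (∃ m : vanishing Q, 0 < ν₁.real {k + m}) ∧
    ∃ m : vanishing Q, 0 < ν₂.real {k + m}}
  have hι₁ : ∀ k ∈ K, ∀ m : vanishing Q, ν₁.real {k + m} ≠ 0 →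
      ∃ m : vanishing Q, 0 < ν₂.real {k + m} := by
    intro k hk m hm
    have := heq k hk 0 K.zero_mem m 0
    rw [ZeroMemClass.coe_zero, add_zero] at this
    exact ⟨_, hpos (right_ne_zero_of_mul (this ▸ mul_ne_zero hm h0))⟩
  have hι₂ : ∀ l ∈ K, ∀ n : vanishing Q, ν₂.real {l + n} ≠ 0 →
      ∃ m : vanishing Q, 0 < ν₁.real {l + m} := by
    intro l hl n hn
    obtain ⟨k, hk, m, rfl⟩ := hdecomp u₀ (hN₁ u₀ hu₀)
    exact ⟨_, hpos (left_ne_zero_of_mul (heq k hk l hl m n ▸ mul_ne_zero hu₀ hn))⟩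
  have hιzero : ∀ k (hk : k ∈ K), (¬ ∃ i : ι, i.1 = k) → ∀ m : vanishing Q,
      ν₁.real {k + m} = 0 ∧ ν₂.real {k + m} = 0 := by
    intro k hk hni m
    constructor <;> by_contra hm
    · exact hni ⟨⟨k, hk, ⟨m, hpos hm⟩, hι₁ k hk m hm⟩, rfl⟩
    · exact hni ⟨⟨k, hk, hι₂ k hk m hm, ⟨m, hpos hm⟩⟩, rfl⟩
  have h00 : ν₂.real {(0 : WeakProd P) + (0 : vanishing Q)} ≠ 0 := by simpa using h0
  let k₀ : ι := ⟨0, K.zero_mem, hι₂ 0 K.zero_mem 0 h00, ⟨0, hpos h00⟩⟩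
  have hfin : ∀ (μ : Measure (WeakProd P)) [IsProbabilityMeasure μ] (k : ι) (ε : ℝ), 0 < ε →
      {m : vanishing Q | ε ≤ μ.real {k.1 + m}}.Finite := fun μ _ k ε hε =>
    Set.Finite.preimage (f := fun m : vanishing Q => k.1 + (m : WeakProd P))
      (s := {x | ε ≤ μ.real {x}}) ((add_right_injective k.1).comp Subtype.val_injective).injOn
      (finite_superlevel μ hε)
  have hcne : ∀ p ∉ Q, c p ≠ 0 := fun p hp => by
    have : Fact (p : ℕ).Prime := ⟨hP p p.2⟩
    exact inv_ne_zero (sub_ne_zero.2 fun h => hp (Or.inl h.symm))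
  have h1a : ∀ p ∉ Q, 1 + a p ≠ 0 := fun p hp h => hp (Or.inr (by linear_combination h))
  obtain ⟨H, φ, ψ, hH, hφψ, hin, hout⟩ := exists_subgroup_of_functional_equation
    (s := s) (t := t) (q := q) (r := r) (k₀ := k₀)
    (F := fun (k : ι) m => ν₁.real {k.1 + m}) (G := fun (k : ι) m => ν₂.real {k.1 + m})
    (exists_nsmul_coordMulOn_eq hP fun p hp => by
      have : Fact (p : ℕ).Prime := ⟨hP p p.2⟩
      exact neg_ne_zero.2
        (mul_ne_zero (mul_ne_zero (two_ne_zero_of_mem hP h2 p) (hcne p hp)) (ha p)))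
    (exists_nsmul_coordMulOn_eq hP fun p hp => by
      have : Fact (p : ℕ).Prime := ⟨hP p p.2⟩
      exact mul_ne_zero (two_ne_zero_of_mem hP h2 p) (hcne p hp))
    (exists_nsmul_coordMulOn_eq hP fun p hp => by
      have : Fact (p : ℕ).Prime := ⟨hP p p.2⟩
      exact mul_ne_zero (hcne p hp) (h1a p hp))
    (fun _ _ => measureReal_nonneg) (fun _ _ => measureReal_nonneg) (hfin ν₁) (hfin ν₂)
    (fun k => k.2.2.1) (fun k => k.2.2.2)
    (fun k l m n => heq k.1 k.2.1 l.1 l.2.1 m n)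
    (fun m => by simpa [k₀] using hmax _)
  have hψ0 : ψ k₀ ≠ 0 := by
    rw [← (hin k₀ 0 H.zero_mem).2]
    exact h00
  have hprop : ∀ x, ν₁.real {x} * ψ k₀ = φ k₀ * ν₂.real {x} := by
    intro x
    by_cases hx : ∀ p, a p = 1 → coord p x = 0
    · obtain ⟨k, hk, m, rfl⟩ := hdecomp x hx
      by_cases hki : ∃ i : ι, i.1 = k
      · obtain ⟨i, rfl⟩ := hki
        by_cases hm : m ∈ H
        · rw [(hin i m hm).1, (hin i m hm).2, hφψ]
        · rw [(hout i m hm).1, (hout i m hm).2, zero_mul, mul_zero]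
      · rw [(hιzero k hk hki m).1, (hιzero k hk hki m).2, zero_mul, mul_zero]
    · rw [not_imp_comm.1 (hN₁ x) hx, not_imp_comm.1 (hN₂ x) hx, zero_mul, mul_zero]
  -- Two proportional probability distributions are equal.
  have hφ0 : ψ k₀ = φ k₀ := by
    have := tsum_congr (L := .unconditional _) hprop
    rwa [tsum_mul_right, tsum_mul_left, tsum_measureReal_singleton, tsum_measureReal_singleton,
      one_mul, mul_one] at this
  refine ⟨Measure.ext_of_singleton fun x => ?_, H.map (vanishing Q).subtype, ?_, ?_, ?_⟩
  · rw [← measureReal_eq_measureReal_iff]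
    refine mul_right_cancel₀ hψ0 ?_
    rw [hprop, hφ0, mul_comm]
  · exact (H : Set (vanishing Q)).toFinite.image _ |>.to_subtype
  · rintro _ ⟨d, hd, rfl⟩ x
    rw [AddSubgroup.coe_subtype]
    by_cases hx : ∀ p, a p = 1 → coord p x = 0
    · obtain ⟨k, hk, m, rfl⟩ := hdecomp x hx
      rw [add_assoc, ← AddSubgroup.coe_add]
      by_cases hki : ∃ i : ι, i.1 = k
      · obtain ⟨i, rfl⟩ := hki
        by_cases hm : m ∈ H
        · rw [(hin i m hm).2, (hin i (m + d) (H.add_mem hm hd)).2]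
        · rw [(hout i m hm).2, (hout i (m + d) fun h => hm ((H.add_mem_cancel_right hd).1 h)).2]
      · rw [(hιzero k hk hki _).2, (hιzero k hk hki _).2]
    · rw [not_imp_comm.1 (hN₂ x) hx, not_imp_comm.1 (hN₂ (x + d)) fun h => hx fun p hp => ?_]
      simpa [d.2 p (Or.inl hp)] using h p hp
  · intro x hx
    obtain ⟨k, hk, m, rfl⟩ := hdecomp x (hN₂ x hx)
    have hki : ∃ i : ι, i.1 = k := by
      by_contra hki
      exact hx (hιzero k hk hki m).2
    obtain ⟨i, rfl⟩ := hki
    have hm : m ∈ H := by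
      by_contra hm
      exact hx (hout i m hm).2
    refine mem_of_coord hP (AddSubgroup.mem_map_of_mem (vanishing Q).subtype hm) fun p hp => ?_
    rw [AddSubgroup.coe_subtype] at hp
    simp only [map_add, coord_coordMul, hp, add_zero]
    by_cases hap : a p = -1
    · rw [hap]; ring
    · rw [hk p hap]; ring

/-! ### Factorization of the common distribution -/

lemma real_map_sub_singleton (μ : Measure (WeakProd P)) (v x : WeakProd P) :
    (μ.map (· - v)).real {x} = μ.real {x + v} := by
  rw [measureReal_def, measureReal_def, Measure.map_apply .of_discrete (MeasurableSet.singleton _)]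
  congr 2
  ext y
  simp [sub_eq_iff_eq_add]

lemma haarDistribution_map_add (K : AddSubgroup (WeakProd P)) {g : WeakProd P} (hg : g ∈ K) :
    (haarDistribution K).map (· + g) = haarDistribution K := by
  refine Measure.ext_of_singleton fun x => ?_
  have hpre : (· + g) ⁻¹' {x} = {x - g} := by
    ext y
    rw [Set.mem_preimage, Set.mem_singleton_iff, Set.mem_singleton_iff, eq_sub_iff_add_eq]
  rw [Measure.map_apply .of_discrete (MeasurableSet.singleton _), hpre, haarDistribution,
    uniformOn, cond_apply (.of_discrete), cond_apply (.of_discrete)]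
  congr 1
  by_cases hx : x ∈ K
  · rw [Set.inter_eq_right.2 (Set.singleton_subset_iff.2 (K.sub_mem hx hg)),
      Set.inter_eq_right.2 (Set.singleton_subset_iff.2 hx), Measure.count_singleton,
      Measure.count_singleton]
  · have hxg : x - g ∉ K := fun h => hx (by simpa using K.add_mem h hg)
    rw [Set.inter_singleton_eq_empty.2 hx, Set.inter_singleton_eq_empty.2 hxg]

/-- Moving the points of a `K`-invariant distribution within their `K`-cosets by a map `π` is
undone by convolution with the uniform distribution on `K`. -/
lemma haarDistribution_conv_map (K : AddSubgroup (WeakProd P)) [Finite K]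
    {lam : Measure (WeakProd P)} [IsProbabilityMeasure lam]
    (hinv : ∀ d ∈ K, ∀ x, lam {x + d} = lam {x})
    {π : WeakProd P → WeakProd P} (hπ : ∀ᵐ x ∂lam, x - π x ∈ K) :
    haarDistribution K ∗ lam.map π = lam := by
  have hm : IsProbabilityMeasure (haarDistribution K) :=
    isProbabilityMeasure_uniformOn (Set.toFinite _) ⟨0, K.zero_mem⟩
  have hprob : IsProbabilityMeasure (lam.map π) :=
    Measure.isProbabilityMeasure_map (Measurable.of_discrete (f := π)).aemeasurable
  have hK : ∀ᵐ k ∂(haarDistribution K), k ∈ K := by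
    rw [haarDistribution, uniformOn]
    exact ae_cond_mem .of_discrete
  have hhaar : ∀ g ∈ K, ∀ f : WeakProd P → ENNReal,
      ∫⁻ k, f (k + g) ∂(haarDistribution K) = ∫⁻ k, f k ∂(haarDistribution K) := by
    intro g hg f
    conv_rhs => rw [← haarDistribution_map_add K hg]
    rw [lintegral_map .of_discrete .of_discrete]
  have hlam : ∀ k ∈ K, ∀ f : WeakProd P → ENNReal, ∫⁻ x, f (k + x) ∂lam = ∫⁻ x, f x ∂lam := by
    intro k hk f
    have hmap : lam.map (k + ·) = lam := by
      refine Measure.ext_of_singleton fun x => ?_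
      have hpre : (k + ·) ⁻¹' {x} = {x - k} := by
        ext y
        rw [Set.mem_preimage, Set.mem_singleton_iff, Set.mem_singleton_iff, eq_sub_iff_add_eq,
          add_comm]
      rw [Measure.map_apply .of_discrete (MeasurableSet.singleton _), hpre, ← hinv k hk,
        sub_add_cancel]
    conv_rhs => rw [← hmap]
    rw [lintegral_map .of_discrete .of_discrete]
  refine Measure.ext_of_lintegral _ fun f _ => ?_
  calc ∫⁻ z, f z ∂(haarDistribution K ∗ lam.map π)
      = ∫⁻ k, ∫⁻ x, f (k + π x) ∂lam ∂(haarDistribution K) := by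
        rw [Measure.lintegral_conv .of_discrete]
        refine lintegral_congr fun k => ?_
        rw [lintegral_map .of_discrete .of_discrete]
    _ = ∫⁻ x, ∫⁻ k, f (k + π x) ∂(haarDistribution K) ∂lam :=
        lintegral_lintegral_swap (Measurable.of_discrete.aemeasurable)
    _ = ∫⁻ x, ∫⁻ k, f (k + x) ∂(haarDistribution K) ∂lam := by
        refine lintegral_congr_ae ?_
        filter_upwards [hπ] with x hx
        rw [← hhaar _ hx fun k => f (k + π x)]
        refine lintegral_congr fun k => ?_
        rw [add_assoc, sub_add_cancel]
    _ = ∫⁻ k, ∫⁻ x, f (k + x) ∂lam ∂(haarDistribution K) :=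
        lintegral_lintegral_swap (Measurable.of_discrete.aemeasurable)
    _ = ∫⁻ k, ∫⁻ x, f x ∂lam ∂(haarDistribution K) := by
        refine lintegral_congr_ae ?_
        filter_upwards [hK] with k hk
        exact hlam k hk f
    _ = ∫⁻ x, f x ∂lam := by rw [lintegral_const, measure_univ, mul_one]

lemma mem_support_iff_singleton {μ : Measure (WeakProd P)} {x : WeakProd P} :
    x ∈ μ.support ↔ μ {x} ≠ 0 := by
  rw [Measure.mem_support_iff_forall]
  refine ⟨fun h => (h {x} (by simp)).ne', fun h U hU => ?_⟩
  exact (pos_iff_ne_zero.2 h).trans_le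
    (measure_mono (Set.singleton_subset_iff.2 (mem_of_mem_nhds hU)))

/-- If `lam` is invariant under a finite subgroup containing `(I + α)(supp lam)`, then the
subgroup `G` generated by its support splits as `(I + α)(G) × (G ∩ ker (I + α))`, because
`I + α` acts on each factor either as `0` or invertibly. The second factor `ω` is the image of
`lam` under the projection of `G` onto `G ∩ ker (I + α)`. -/
theorem exists_decomposition (hP : ∀ p ∈ P, p.Prime) {a : (p : P) → ZMod (p : ℕ)}
    {lam : Measure (WeakProd P)} [IsProbabilityMeasure lam] {G H : AddSubgroup (WeakProd P)}
    (hG : G = AddSubgroup.closure lam.support) [Finite H]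
    (hinv : ∀ d ∈ H, ∀ x, lam {x + d} = lam {x})
    (hH : ∀ x ∈ lam.support, x + coordMul a x ∈ H) :
    ∃ G₁ G₂ : AddSubgroup (WeakProd P),
      G₁ = G.map (AddMonoidHom.id (WeakProd P) + coordMul a) ∧
      Finite G₁ ∧ G₂ ≤ G ∧ G₁ ⊔ G₂ = G ∧ G₁ ⊓ G₂ = ⊥ ∧
      ∃ ω : Measure (WeakProd P), IsProbabilityMeasure ω ∧
        ω ((G₂ : Set (WeakProd P))ᶜ) = 0 ∧ lam = haarDistribution G₁ ∗ ω := by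
  set β := AddMonoidHom.id (WeakProd P) + coordMul a with hβ
  have hβc : ∀ x p, coord p (β x) = (1 + a p) * coord p x := fun x p => by
    simp [hβ, add_mul]
  have hle : G.map β ≤ H := by
    rw [hG, AddMonoidHom.map_closure, AddSubgroup.closure_le]
    rintro _ ⟨x, hx, rfl⟩
    exact hH x hx
  have hfin : Finite (G.map β) := ((H : Set (WeakProd P)).toFinite.subset hle).to_subtype
  -- `coordMul b` is an inverse of `1 + α` away from the kernel of `1 + α`.
  let b : (p : P) → ZMod (p : ℕ) := fun p => (1 + a p)⁻¹
  let π : WeakProd P → WeakProd P := fun x => x - β (coordMul b x)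
  have hmem₁ : ∀ x ∈ G, β (coordMul b x) ∈ G.map β := fun x hx =>
    AddSubgroup.mem_map_of_mem β (mem_of_coord hP hx fun p hp => by simp [hp])
  have hβG : G.map β ≤ G := by
    rintro _ ⟨x, hx, rfl⟩
    exact mem_of_coord hP hx fun p hp => by rw [hβc, hp, mul_zero]
  have hmem₂ : ∀ x ∈ G, π x ∈ G ⊓ β.ker := by
    refine fun x hx => ⟨G.sub_mem hx (hβG (hmem₁ x hx)), ext_coord fun p => ?_⟩
    have : Fact (p : ℕ).Prime := ⟨hP p p.2⟩
    simp only [π, b, hβc, map_sub, coord_coordMul, map_zero]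
    by_cases h : 1 + a p = 0
    · rw [h, zero_mul, zero_mul, sub_zero]
    · rw [← mul_assoc (1 + a p) _ (coord p x), mul_inv_cancel₀ h, one_mul, sub_self]
  have hae : ∀ᵐ x ∂lam, x ∈ G := by
    filter_upwards [Measure.support_mem_ae (μ := lam)] with x hx
    exact hG ▸ AddSubgroup.subset_closure hx
  refine ⟨G.map β, G ⊓ β.ker, rfl, hfin, inf_le_left, ?_, ?_, lam.map π, ?_, ?_, ?_⟩
  · refine le_antisymm (sup_le hβG inf_le_left) fun x hx => ?_
    exact AddSubgroup.mem_sup.2 ⟨_, hmem₁ x hx, _, hmem₂ x hx, add_sub_cancel _ _⟩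
  · rw [eq_bot_iff]
    rintro _ ⟨⟨x, -, rfl⟩, -, hx⟩
    have hx : β (β x) = 0 := hx
    refine ext_coord fun p => ?_
    have : Fact (p : ℕ).Prime := ⟨hP p p.2⟩
    have := congrArg (coord p) hx
    rw [hβc, hβc, map_zero] at this
    rw [hβc, map_zero]
    rcases mul_eq_zero.1 this with h | h
    · rw [h, zero_mul]
    · exact h
  · exact Measure.isProbabilityMeasure_map Measurable.of_discrete.aemeasurable
  · rw [Measure.map_apply .of_discrete .of_discrete]
    exact measure_mono_null (fun x hx hxG => hx (hmem₂ x hxG)) (ae_iff.1 hae)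
  · refine (haarDistribution_conv_map _ (fun d hd => hinv d (hle hd)) ?_).symm
    filter_upwards [hae] with x hx
    simpa [π] using hmem₁ x hx

end WeakProd

theorem theorem2p12
    (P : Set ℕ) (hP : ∀ p ∈ P, p.Prime) (h2 : 2 ∉ P)
    (α : WeakProd P ≃+ WeakProd P)
    {Ω : Type*} [MeasurableSpace Ω] (ρ : Measure Ω) [IsProbabilityMeasure ρ]
    (ξ₁ ξ₂ : Ω → WeakProd P) (hξ₁ : Measurable ξ₁) (hξ₂ : Measurable ξ₂)
    (hindep : IndepFun ξ₁ ξ₂ ρ)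
    (μ₁ μ₂ : Measure (WeakProd P)) (hμ₁ : ρ.map ξ₁ = μ₁) (hμ₂ : ρ.map ξ₂ = μ₂)
    (hsymm : CondSymmetric (fun w => ξ₁ w + α (ξ₂ w)) (fun w => ξ₁ w + ξ₂ w) ρ) :
    ∃ (G : AddSubgroup (WeakProd P)) (lam : Measure (WeakProd P)),
      IsProbabilityMeasure lam ∧
      lam ((G : Set (WeakProd P))ᶜ) = 0 ∧
      IsShift μ₁ lam ∧ IsShift μ₂ lam ∧
      IsLeast {K : AddSubgroup (WeakProd P) | lam.support ⊆ (K : Set (WeakProd P))} G ∧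
      (∃ G₁ G₂ : AddSubgroup (WeakProd P),
        G₁ = G.map (AddMonoidHom.id (WeakProd P) + α.toAddMonoidHom) ∧
        Finite G₁ ∧ G₂ ≤ G ∧ G₁ ⊔ G₂ = G ∧ G₁ ⊓ G₂ = ⊥ ∧
        ∃ ω : Measure (WeakProd P), IsProbabilityMeasure ω ∧
          ω ((G₂ : Set (WeakProd P))ᶜ) = 0 ∧
          lam = haarDistribution G₁ ∗ ω) ∧
      (∀ {Ω' : Type*} [MeasurableSpace Ω'] (ρ' : Measure Ω') [IsProbabilityMeasure ρ']
        (η₁ η₂ : Ω' → WeakProd P), Measurable η₁ → Measurable η₂ → IndepFun η₁ η₂ ρ' →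
        ρ'.map η₁ = lam → ρ'.map η₂ = lam →
        CondSymmetric (fun w => η₁ w + α (η₂ w)) (fun w => η₁ w + η₂ w) ρ') := by
  have hp₁ : IsProbabilityMeasure μ₁ := hμ₁ ▸ Measure.isProbabilityMeasure_map hξ₁.aemeasurable
  have hp₂ : IsProbabilityMeasure μ₂ := hμ₂ ▸ Measure.isProbabilityMeasure_map hξ₂.aemeasurable
  obtain ⟨a, ha⟩ := WeakProd.exists_eq_coordMul hP α.toAddMonoidHom
  have hα : ∀ x, α x = WeakProd.coordMul a x := fun x => DFunLike.congr_fun ha x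
  have hsym : SymmetricForms (WeakProd.coordMul a) μ₁ μ₂ := by
    simp only [hα] at hsymm
    rwa [WeakProd.condSymmetric_iff_symmetricForms hξ₁ hξ₂ hindep, hμ₁, hμ₂] at hsymm
  obtain ⟨x₀, hx₀⟩ := WeakProd.exists_measureReal_singleton_ne_zero μ₂
  obtain ⟨v, -, hv⟩ := exists_max_of_finite_superlevel (f := fun x => μ₂.real {x})
    (fun ε hε => WeakProd.finite_superlevel μ₂ hε) ⟨x₀, measureReal_nonneg.lt_of_ne' hx₀⟩
  -- Translating `ξ₁` by `α v` and `ξ₂` by `-v` adds the constant `α v - v` to `L₁` and leaves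
  -- `L₂` fixed. The choice of `v` moves a point of maximal mass of `μ₂` to the origin.
  have hsym' := hsym.shift v
  set lam := μ₂.map (· - v) with hlam
  have hplam : IsProbabilityMeasure lam :=
    Measure.isProbabilityMeasure_map Measurable.of_discrete.aemeasurable
  have hp₁' : IsProbabilityMeasure (μ₁.map (· + WeakProd.coordMul a v)) :=
    Measure.isProbabilityMeasure_map Measurable.of_discrete.aemeasurable
  obtain ⟨heq, H, hH, hinv, hmem⟩ := WeakProd.exists_finite_subgroup_of_symmetricForms hP h2
    (WeakProd.coord_ne_zero_of_injective hP fun x y h => α.injective (by rw [hα, hα, h])) hsym'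
    (fun x => by
      rw [hlam, WeakProd.real_map_sub_singleton, WeakProd.real_map_sub_singleton, zero_add]
      exact hv _)
  rw [heq] at hsym'
  refine ⟨AddSubgroup.closure lam.support, lam, hplam, ?_, ⟨-WeakProd.coordMul a v, ?_⟩, ⟨v, ?_⟩,
    ⟨AddSubgroup.subset_closure, fun K hK => (AddSubgroup.closure_le K).2 hK⟩, ?_, ?_⟩
  · exact measure_mono_null (Set.compl_subset_compl.2 AddSubgroup.subset_closure)
      Measure.measure_compl_support
  · rw [Measure.conv_dirac, ← heq, Measure.map_map .of_discrete .of_discrete]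
    convert Measure.map_id.symm
    ext x : 1
    simp
  · rw [Measure.conv_dirac, hlam, Measure.map_map .of_discrete .of_discrete]
    convert Measure.map_id.symm
    ext x : 1
    simp
  · rw [ha]
    refine WeakProd.exists_decomposition hP rfl (H := H) (fun d hd x => ?_) fun x hx => hmem x ?_
    · exact (measureReal_eq_measureReal_iff (by finiteness) (by finiteness)).1 (hinv d hd x)
    · exact ENNReal.toReal_ne_zero.2
        ⟨WeakProd.mem_support_iff_singleton.1 hx, measure_ne_top _ _⟩
  · intro Ω' _ ρ' _ η₁ η₂ hη₁ hη₂ hη h₁ h₂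
    simp only [hα]
    rwa [WeakProd.condSymmetric_iff_symmetricForms hη₁ hη₂ hη, h₁, h₂]
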